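/- A (Clifford) ZX diagram is a finite open graph whose internal vertices are Z spiders, X spiders (with phases in $\{0,\frac{\pi}{2},\pi,\frac{3\pi}{2}\}$) and two-legged Hadamard boxes, and whose boundary vertices have degree one; its interpretation $[\![D]\!]$ is the linear map obtained by contracting the tensors $|0\cdots0\rangle+e^{i\alpha}|1\cdots1\rangle$, $|{+}\cdots{+}\rangle+e^{i\alpha}|{-}\cdots{-}\rangle$ and $|0\rangle\langle+|+|1\rangle\langle-|$ of its vertices. Interpretations are compared up to a nonzero scalar. An error $\mathcal E$ in $D$ is a set of pairs $(e,t)$ with $e$ an edge and $t\in\{X,Z\}$; $D+\mathcal E$ is $D$ with the corresponding Pauli operators inserted on its edges, and the weight of $\mathcal E$ is the number of distinct edges occurring in it. The ZX distance of $D$ is the minimal weight of an error $\mathcal E$ with $[\![D+\mathcal E]\!]\neq[\![D]\!]$ and $[\![D+\mathcal E]\!]\neq0$ (it is $\infty$ if there is none). A rewrite $D_1\to D_2$ between diagrams with the same boundary and with $[\![D_1]\!]=[\![D_2]\!]$ is distance-preserving if, for every diagram $D$ in which $D_1$ occurs, the diagram obtained from $D$ by replacing $D_1$ by $D_2$ has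 ZX distance at least that of $D$, and the same holds for the inverse rewrite $D_2\to D_1$. Theorem. Let $n$ be an even natural number. Let $D_1$ be the phase-free Z spider with $n+1$ legs. Let $D_2$ be the diagram with the same $n+1$ boundary vertices that consists of the following phase-free Z spiders: $\frac n2$ four-legged spiders $s_1,\dots,s_{n/2}$, a spider $a$ with $\frac n2$ legs, and a spider $b$ with $\frac n2+1$ legs. Each $s_i$ is connected by one edge to $a$, by one edge to $b$, and to the boundary vertices $2i-1$ and $2i$; the remaining leg of $b$ is connected to the boundary vertex $n+1$. Then $[\![D_1]\!]=[\![D_2]\!]$ (up to a nonzero scalar) and the rewrite $D_1\to D_2$ is distance-preserving. -/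

import Mathlib

/-! Clifford ZX diagrams as open graphs, their interpretation, errors made of edge flips, the ZX
distance, and distance-preserving rewrites. -/

/-- The types of the non-boundary nodes of a ZX diagram: Z spiders, X spiders, Hadamard boxes. -/
inductive NodeKind
  | Z
  | X
  | H

/-- The two types of edge flips. -/
inductive FlipKind
  | X
  | Z

/-- A Clifford ZX diagram whose boundary nodes are labelled by `ι`. It is a finite open graph
(parallel edges and self-loops are allowed) with vertex set `Node ⊕ ι`. An edge `e` has the two
half-edges `(e, false)` and `(e, true)`, and `attach` sends a half-edge to its vertex. The phase of
a spider `v` is `phase v * π / 2`; the phase of a Hadamard box plays no role. Hadamard boxes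
have exactly two legs and boundary nodes exactly one. -/
structure ZXDiagram (ι : Type) where
  Node : Type
  Edge : Type
  [fintypeNode : Fintype Node]
  [fintypeEdge : Fintype Edge]
  [decEqNode : DecidableEq Node]
  [decEqEdge : DecidableEq Edge]
  attach : Edge × Bool → Node ⊕ ι
  kind : Node → NodeKind
  phase : Node → ZMod 4
  hadamard_degree : ∀ v, kind v = NodeKind.H → Nat.card {h // attach h = Sum.inl v} = 2
  boundary_degree : ∀ i, ∃! h, attach h = Sum.inr i

attribute [instance] ZXDiagram.fintypeNode ZXDiagram.fintypeEdge ZXDiagram.decEqNode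
  ZXDiagram.decEqEdge

/-- The Pauli X matrix. -/
def pauliX : Matrix Bool Bool ℂ := fun a b => if a = b then 0 else 1

/-- The Pauli Z matrix. -/
def pauliZ : Matrix Bool Bool ℂ := fun a b => if a = b then (if a then -1 else 1) else 0

/-- Coordinates of the vectors `|0⟩`, `|1⟩`, `|+⟩`, `|-⟩`; `false` is the basis index 0. -/
def ketZero : Bool → ℂ := fun b => if b then 0 else 1

def ketOne : Bool → ℂ := fun b => if b then 1 else 0

noncomputable def ketPlus : Bool → ℂ := fun _ => 1 / (Real.sqrt 2 : ℂ)

noncomputable def ketMinus : Bool → ℂ :=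
  fun b => if b then -1 / (Real.sqrt 2 : ℂ) else 1 / (Real.sqrt 2 : ℂ)

namespace ZXDiagram

variable {ι κ : Type}

/-- An error is a finite set of edge flips. -/
abbrev Error (D : ZXDiagram ι) : Type := Finset (D.Edge × FlipKind)

open Classical in
/-- The weight of an error: the number of edges affected by it. -/
noncomputable def weight (D : ZXDiagram ι) (F : D.Error) : ℕ := (F.image Prod.fst).card

open Classical in
/-- The half-edges attached to a node. -/
noncomputable def legs (D : ZXDiagram ι) (v : D.Node) : Finset (D.Edge × Bool) :=
  Finset.univ.filter fun h => D.attach h = Sum.inl v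

open Classical in
/-- The entry of the tensor of the node `v` when its legs carry the basis labels `s`:
`|0…0⟩ + e^{iα} |1…1⟩` for a Z spider, `|+…+⟩ + e^{iα} |-…-⟩` for an X spider and
`|0⟩⟨+| + |1⟩⟨-|` for a Hadamard box. -/
noncomputable def nodeTensor (D : ZXDiagram ι) (v : D.Node) (s : D.Edge × Bool → Bool) : ℂ :=
  match D.kind v with
  | NodeKind.Z => (∏ h ∈ D.legs v, ketZero (s h)) +
      Complex.I ^ (D.phase v).val * ∏ h ∈ D.legs v, ketOne (s h)
  | NodeKind.X => (∏ h ∈ D.legs v, ketPlus (s h)) +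
      Complex.I ^ (D.phase v).val * ∏ h ∈ D.legs v, ketMinus (s h)
  | NodeKind.H =>
      if ∀ h ∈ D.legs v, s h = true then -1 / (Real.sqrt 2 : ℂ) else 1 / (Real.sqrt 2 : ℂ)

open Classical in
/-- The operator on the edge `e` after the flips of `F`: identity, X, Z, or their product. -/
noncomputable def edgeOperator (D : ZXDiagram ι) (F : D.Error) (e : D.Edge) :
    Matrix Bool Bool ℂ :=
  (if (e, FlipKind.X) ∈ F then pauliX else 1) * (if (e, FlipKind.Z) ∈ F then pauliZ else 1)

open Classical in
/-- The interpretation of the diagram `D + F`, by contraction of the tensor network. It is given by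
the coefficients, in the computational basis, of the linear map of the diagram with all
its boundary wires bent to outputs. The interpretation of `D` itself is `D.interp ∅`. -/
noncomputable def interp (D : ZXDiagram ι) (F : D.Error) : (ι → Bool) → ℂ := fun x =>
  ∑ s : D.Edge × Bool → Bool,
    (∏ v, D.nodeTensor v s) * (∏ e, D.edgeOperator F e (s (e, false)) (s (e, true))) *
      (if ∀ h i, D.attach h = Sum.inr i → s h = x i then 1 else 0)

end ZXDiagram

/-- Equality of interpretations. The calculus ignores nonzero global scalars. -/
def EqUpToScalar {ι : Type} (f g : (ι → Bool) → ℂ) : Prop := ∃ c : ℂ, c ≠ 0 ∧ f = c • g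

namespace ZXDiagram

variable {ι κ : Type}

/-- A trivial error does not change the interpretation. -/
def IsTrivial (D : ZXDiagram ι) (F : D.Error) : Prop := EqUpToScalar (D.interp F) (D.interp ∅)

/-- A detectable error makes the diagram zero. -/
def IsDetectable (D : ZXDiagram ι) (F : D.Error) : Prop := D.interp F = 0

/-- The ZX distance: the minimal weight of a non-trivial undetectable error (`⊤` if there is
none). -/
noncomputable def distance (D : ZXDiagram ι) : ℕ∞ :=
  ⨅ F ∈ {F : D.Error | ¬ D.IsTrivial F ∧ ¬ D.IsDetectable F}, (D.weight F : ℕ∞)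

end ZXDiagram

/-- A diagram that can serve as a side of a rewrite rule: every edge has at least one end
that is not a boundary node, i.e. there is no bare wire joining two boundary nodes. -/
structure ZXPattern (ι : Type) extends ZXDiagram ι where
  no_wire : ∀ e, ∃ b v, attach (e, b) = Sum.inl v

namespace ZXPattern

variable {ι κ : Type}

theorem exists_neighbour (P : ZXPattern ι) (i : ι) :
    ∃ v, ∃ e b, P.attach (e, b) = Sum.inr i ∧ P.attach (e, !b) = Sum.inl v := by
  obtain ⟨⟨e, b⟩, h, -⟩ := P.boundary_degree i
  obtain ⟨c, v, hv⟩ := P.no_wire e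
  refine ⟨v, e, b, h, ?_⟩
  rcases Bool.eq_or_eq_not c b with rfl | rfl
  · rw [h] at hv
    cases hv
  · exact hv

/-- The node at the other end of the boundary edge of `i`. -/
noncomputable def neighbour (P : ZXPattern ι) (i : ι) : P.Node := (P.exists_neighbour i).choose

theorem neighbour_spec (P : ZXPattern ι) (i : ι) :
    ∃ e b, P.attach (e, b) = Sum.inr i ∧ P.attach (e, !b) = Sum.inl (P.neighbour i) :=
  (P.exists_neighbour i).choose_spec

theorem neighbour_eq (P : ZXPattern ι) {i : ι} {e : P.Edge} {b : Bool} {v : P.Node}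
    (h : P.attach (e, b) = Sum.inr i) (h₂ : P.attach (e, !b) = Sum.inl v) :
    P.neighbour i = v := by
  obtain ⟨e₁, b₁, h₃, h₄⟩ := P.neighbour_spec i
  have := (P.boundary_degree i).unique h h₃
  simp only [Prod.mk.injEq] at this
  obtain ⟨rfl, rfl⟩ := this
  rw [h₂] at h₄
  exact (Sum.inl.inj h₄).symm

/-- The internal edges: no end is a boundary node. -/
abbrev InternalEdge (P : ZXPattern ι) : Type :=
  {e : P.Edge // ∀ b, (P.attach (e, b)).isLeft = true}

/-- The incidence map of `plug`. -/
noncomputable def plugAttach (C : ZXDiagram (ι ⊕ κ)) (P : ZXPattern ι) :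
    (C.Edge ⊕ P.InternalEdge) × Bool → (C.Node ⊕ P.Node) ⊕ κ
  | (Sum.inl e, b) =>
    match C.attach (e, b) with
    | Sum.inl v => Sum.inl (Sum.inl v)
    | Sum.inr (Sum.inl i) => Sum.inl (Sum.inr (P.neighbour i))
    | Sum.inr (Sum.inr k) => Sum.inr k
  | (Sum.inr e, b) => Sum.inl (Sum.inr ((P.attach (e.1, b)).getLeft (e.2 b)))

theorem plugAttach_inl_eq (C : ZXDiagram (ι ⊕ κ)) (P : ZXPattern ι) (h : C.Edge × Bool) :
    plugAttach C P (Sum.inl h.1, h.2) =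
      match C.attach h with
      | Sum.inl v => Sum.inl (Sum.inl v)
      | Sum.inr (Sum.inl i) => Sum.inl (Sum.inr (P.neighbour i))
      | Sum.inr (Sum.inr k) => Sum.inr k := rfl

theorem plugAttach_card_left (C : ZXDiagram (ι ⊕ κ)) (P : ZXPattern ι) (v : C.Node) :
    Nat.card {h // plugAttach C P h = Sum.inl (Sum.inl v)} =
      Nat.card {h // C.attach h = Sum.inl v} := by
  symm
  refine Nat.card_eq_of_bijective
    (fun h => ⟨(Sum.inl h.1.1, h.1.2), by rw [plugAttach_inl_eq, h.2]⟩) ⟨?_, ?_⟩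
  · rintro ⟨⟨e, b⟩, h⟩ ⟨⟨e', b'⟩, h'⟩ heq
    simpa using heq
  · rintro ⟨⟨e | e, b⟩, h⟩
    · refine ⟨⟨(e, b), ?_⟩, rfl⟩
      rw [plugAttach_inl_eq C P (e, b)] at h
      rcases hc : C.attach (e, b) with w | i | k <;> simp_all
    · simp [plugAttach] at h

theorem plugAttach_card_right (C : ZXDiagram (ι ⊕ κ)) (P : ZXPattern ι) (v : P.Node) :
    Nat.card {h // plugAttach C P h = Sum.inl (Sum.inr v)} =
      Nat.card {h // P.attach h = Sum.inl v} := by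
  symm
  choose port hport huniq using fun i : ι => C.boundary_degree (Sum.inl i)
  have key : ∀ h : {h // P.attach h = Sum.inl v},
      ∃ g : {h // plugAttach C P h = Sum.inl (Sum.inr v)},
        (∀ i, P.attach (h.1.1, !h.1.2) = Sum.inr i →
          g.1 = (Sum.inl (port i).1, (port i).2)) ∧
        (∀ w, P.attach (h.1.1, !h.1.2) = Sum.inl w → ∃ p, g.1 = (Sum.inr ⟨h.1.1, p⟩, h.1.2)) := by
    rintro ⟨⟨e, b⟩, h⟩
    rcases hc : P.attach (e, !b) with w | i
    · have p : ∀ c, (P.attach (e, c)).isLeft = true := by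
        intro c
        rcases Bool.eq_or_eq_not c b with rfl | rfl
        · simp [h]
        · simp [hc]
      exact ⟨⟨(Sum.inr ⟨e, p⟩, b), by simp [plugAttach, h]⟩, by simp, fun _ _ => ⟨p, rfl⟩⟩
    · refine ⟨⟨(Sum.inl (port i).1, (port i).2), ?_⟩, ?_, by simp⟩
      · have : P.neighbour i = v := P.neighbour_eq hc (by simpa using h)
        rw [plugAttach_inl_eq, hport]
        simp [this]
      · rintro j hj
        cases Sum.inr.inj hj
        rfl
  choose f hf₁ hf₂ using key
  refine Nat.card_eq_of_bijective f ⟨?_, ?_⟩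
  · rintro ⟨⟨e, b⟩, h⟩ ⟨⟨e', b'⟩, h'⟩ heq
    rcases hc : P.attach (e, !b) with w | i <;> rcases hc' : P.attach (e', !b') with w' | i'
    · obtain ⟨p, hp⟩ := hf₂ ⟨(e, b), h⟩ w hc
      obtain ⟨p', hp'⟩ := hf₂ ⟨(e', b'), h'⟩ w' hc'
      rw [heq, hp'] at hp
      simp at hp
      simp [hp]
    · obtain ⟨p, hp⟩ := hf₂ ⟨(e, b), h⟩ w hc
      have hp' := hf₁ ⟨(e', b'), h'⟩ i' hc'
      rw [heq, hp'] at hp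
      simp at hp
    · have hp := hf₁ ⟨(e, b), h⟩ i hc
      obtain ⟨p', hp'⟩ := hf₂ ⟨(e', b'), h'⟩ w' hc'
      rw [heq, hp'] at hp
      simp at hp
    · have hp := hf₁ ⟨(e, b), h⟩ i hc
      have hp' := hf₁ ⟨(e', b'), h'⟩ i' hc'
      rw [heq, hp'] at hp
      simp only [Prod.mk.injEq, Sum.inl.injEq] at hp
      have hpp : port i' = port i := Prod.ext hp.1 hp.2
      have hii : i' = i := by
        have := hport i
        rw [← hpp, hport i'] at this
        simpa using this
      subst hii
      have := (P.boundary_degree i').unique hc hc'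
      simpa using this
  · rintro ⟨⟨e | ⟨e, p⟩, b⟩, h⟩
    · have h₀ := h
      rw [plugAttach_inl_eq C P (e, b)] at h
      rcases hc : C.attach (e, b) with w | i | k
      · simp [hc] at h
      · simp only [hc, Sum.inl.injEq, Sum.inr.injEq] at h
        obtain ⟨e₁, b₁, h₁, h₂⟩ := P.neighbour_spec i
        refine ⟨⟨(e₁, !b₁), by rw [h₂, h]⟩, Subtype.ext ?_⟩
        rw [hf₁ _ i (by simpa using h₁)]
        rw [← huniq i _ hc]
      · simp [hc] at h
    · have hv : P.attach (e, b) = Sum.inl v := by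
        have h₁ : (P.attach (e, b)).getLeft (p b) = v := by simpa [plugAttach] using h
        rw [← h₁]
        simp
      obtain ⟨w, hw⟩ := Sum.isLeft_iff.mp (p !b)
      refine ⟨⟨(e, b), hv⟩, Subtype.ext ?_⟩
      obtain ⟨q, hq⟩ := hf₂ ⟨(e, b), hv⟩ w hw
      exact hq

theorem plugAttach_boundary (C : ZXDiagram (ι ⊕ κ)) (P : ZXPattern ι) (k : κ) :
    ∃! h, plugAttach C P h = Sum.inr k := by
  obtain ⟨h, hh, hu⟩ := C.boundary_degree (Sum.inr k)
  refine ⟨(Sum.inl h.1, h.2), by simp only [plugAttach_inl_eq, hh], ?_⟩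
  rintro ⟨e | e, b⟩ h'
  · rw [plugAttach_inl_eq C P (e, b)] at h'
    rcases hc : C.attach (e, b) with w | i | k'
    · simp [hc] at h'
    · simp [hc] at h'
    · simp only [hc, Sum.inr.injEq] at h'
      subst h'
      rw [← hu _ hc]
  · simp [plugAttach] at h'

/-- The diagram obtained by inserting `P` into the context `C`. A context is a diagram whose
boundary nodes are the ports `ι` of the hole together with the boundary `κ` of the whole diagram.
The boundary edge of `P` at `i` and the edge of `C` at the port `i` become one edge. An
edge of `C` may join two ports, a port and a boundary node of the whole diagram, and so on. -/
noncomputable abbrev plug (C : ZXDiagram (ι ⊕ κ)) (P : ZXPattern ι) : ZXDiagram κ where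
  Node := C.Node ⊕ P.Node
  Edge := C.Edge ⊕ P.InternalEdge
  attach := plugAttach C P
  kind := Sum.elim C.kind P.kind
  phase := Sum.elim C.phase P.phase
  hadamard_degree := by
    rintro (v | v) hv
    · rw [plugAttach_card_left]
      exact C.hadamard_degree v hv
    · rw [plugAttach_card_right]
      exact P.hadamard_degree v hv
  boundary_degree := plugAttach_boundary C P

/-- Replacing `P` by `Q` does not decrease the ZX distance of any diagram in which `P` occurs. -/
def DistanceNonDecreasing (P Q : ZXPattern ι) : Prop :=
  ∀ (κ : Type) (C : ZXDiagram (ι ⊕ κ)), (plug C P).distance ≤ (plug C Q).distance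

/-- `P → Q` is a distance-preserving rewrite: the two diagrams have the same interpretation and the
rewrite and its inverse are distance non-decreasing. -/
def DistancePreserving (P Q : ZXPattern ι) : Prop :=
  EqUpToScalar (P.interp ∅) (Q.interp ∅) ∧
    DistanceNonDecreasing P Q ∧ DistanceNonDecreasing Q P

end ZXPattern

/-- The phase-free Z spider with `k` legs. -/
abbrev zSpider (k : ℕ) : ZXPattern (Fin k) where
  Node := Unit
  Edge := Fin k
  attach := fun h => if h.2 then Sum.inr h.1 else Sum.inl ()
  kind := fun _ => NodeKind.Z
  phase := fun _ => 0
  hadamard_degree := fun _ hv => nomatch hv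
  boundary_degree := by
    intro i
    refine ⟨(i, true), by simp, ?_⟩
    rintro ⟨j, b⟩ h
    cases b <;> simp_all
  no_wire := fun e => ⟨false, (), by simp⟩

/-- The decomposition of the `(n + 1)`-legged Z spider, for even `n`, into phase-free Z spiders:
* outer spiders `inl i`, `i < n / 2`, with four legs: the boundary legs `2 i` and `2 i + 1` and one
  internal edge to each of the two hubs;
* the hub `inr false` with `n / 2` legs, one to each outer spider;
* the hub `inr true` with `n / 2 + 1` legs, one to each outer spider and the last boundary leg. -/
abbrev splitSpider (n : ℕ) : ZXPattern (Fin (n + 1)) where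
  Node := Fin (n / 2) ⊕ Bool
  Edge := Fin (n + 1) ⊕ Fin (n / 2) × Bool
  attach
    | (Sum.inl j, true) => Sum.inr j
    | (Sum.inl j, false) =>
      if h : j.val / 2 < n / 2 then Sum.inl (Sum.inl ⟨j.val / 2, h⟩)
      else Sum.inl (Sum.inr true)
    | (Sum.inr (i, _), false) => Sum.inl (Sum.inl i)
    | (Sum.inr (_, c), true) => Sum.inl (Sum.inr c)
  kind := fun _ => NodeKind.Z
  phase := fun _ => 0
  hadamard_degree := fun _ hv => nomatch hv
  boundary_degree := by
    intro i
    refine ⟨(Sum.inl i, true), rfl, ?_⟩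
    rintro ⟨j | ⟨j, c⟩, b⟩ h
    · cases b
      · by_cases hj : j.val / 2 < n / 2 <;> simp [hj] at h
      · simpa using h
    · cases b <;> simp at h
  no_wire := by
    rintro (j | ⟨j, c⟩)
    · by_cases hj : j.val / 2 < n / 2
      · exact ⟨false, Sum.inl ⟨j.val / 2, hj⟩, by simp [hj]⟩
      · exact ⟨false, Sum.inr true, by simp [hj]⟩
    · exact ⟨false, Sum.inl j, rfl⟩

/-!
An error on a plugged diagram splits into a part on the context and a part on the internal edges of
the pattern. A Pauli string on the legs of the pattern can be moved into the context, where it costs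
one edge per leg, so `P → Q` does not decrease distances as soon as every internal error of `Q`
either annihilates `Q` or acts on it like a Pauli string on the legs of `P` of at most its weight.

In the split spider, a nonzero interpretation requires the parity `d` of the X flips on the two
edges of an outer spider to be the same for all outer spiders. If `d` is even, then `k` flipped
outer spiders cost `2 k` edges and move X to their `2 k` legs. If `d` is odd, then the error uses at
least `n / 2` edges, and because X on a set of legs of a Z spider equals X on the complementary set,
at most `n / 2` legs suffice. All Z flips together amount to at most one Z, which may sit on any
leg, in particular on one that already carries an X.
-/

/-- The eigenvalue of the Pauli Z operator on the basis label `b`. -/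
def boolSign (b : Bool) : ℂ := if b then -1 else 1

theorem boolSign_ne_zero (b : Bool) : boolSign b ≠ 0 := by cases b <;> simp [boolSign]

theorem boolSign_xor (a b : Bool) : boolSign (a ^^ b) = boolSign a * boolSign b := by
  cases a <;> cases b <;> simp [boolSign]

section FlipBits

variable {ι κ : Type}

open Classical in
/-- The action on basis labels of Pauli X operators at the positions in `A`. -/
noncomputable def flipBits (A : Finset ι) (x : ι → Bool) : ι → Bool :=
  fun i => x i ^^ decide (i ∈ A)

theorem flipBits_involutive (A : Finset ι) : Function.Involutive (flipBits A) := fun x => by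
  funext i
  simp [flipBits]

theorem flipBits_empty (x : ι → Bool) : flipBits ∅ x = x := by
  funext i
  simp [flipBits]

theorem flipBits_map_comp (φ : ι ↪ κ) (A : Finset ι) (s : κ → Bool) :
    flipBits (A.map φ) s ∘ φ = flipBits A (s ∘ φ) := by
  funext i
  simp [flipBits]

theorem flipBits_map_inl_elim (A : Finset ι) (z : ι → Bool) (y : κ → Bool) :
    flipBits (A.map Function.Embedding.inl) (Sum.elim z y) = Sum.elim (flipBits A z) y := by
  funext j
  rcases j with j | j <;> simp [flipBits]

theorem flipBits_compl [Fintype ι] [DecidableEq ι] (A : Finset ι) (x : ι → Bool) (i : ι) :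
    flipBits Aᶜ x i = !flipBits A x i := by
  by_cases hi : i ∈ A <;> simp [flipBits, hi]

end FlipBits

namespace EqUpToScalar

variable {ι : Type} {f g h : (ι → Bool) → ℂ}

theorem refl (f : (ι → Bool) → ℂ) : EqUpToScalar f f := ⟨1, one_ne_zero, (one_smul ℂ f).symm⟩

theorem symm (hfg : EqUpToScalar f g) : EqUpToScalar g f := by
  obtain ⟨c, hc, rfl⟩ := hfg
  exact ⟨c⁻¹, inv_ne_zero hc, (inv_smul_smul₀ hc g).symm⟩

theorem trans (hfg : EqUpToScalar f g) (hgh : EqUpToScalar g h) : EqUpToScalar f h := by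
  obtain ⟨c, hc, rfl⟩ := hfg
  obtain ⟨d, hd, rfl⟩ := hgh
  exact ⟨c * d, mul_ne_zero hc hd, (mul_smul c d h).symm⟩

end EqUpToScalar

section ApplyPauli

variable {ι : Type} {f g : (ι → Bool) → ℂ}

/-- The Pauli string with an X at the positions in `A` followed by a Z at the positions in `B`,
applied to a tensor. Where both act the factor is `Z * X`, a Pauli Y up to a scalar. -/
noncomputable def applyPauli (A B : Finset ι) (f : (ι → Bool) → ℂ) : (ι → Bool) → ℂ :=
  fun x => (∏ j ∈ B, boolSign (x j)) * f (flipBits A x)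

theorem applyPauli_empty (f : (ι → Bool) → ℂ) : applyPauli ∅ ∅ f = f := by
  funext x
  simp [applyPauli, flipBits_empty]

theorem EqUpToScalar.applyPauli (A B : Finset ι) (h : EqUpToScalar f g) :
    EqUpToScalar (applyPauli A B f) (applyPauli A B g) := by
  obtain ⟨c, hc, rfl⟩ := h
  exact ⟨c, hc, funext fun x => mul_left_comm _ c _⟩

theorem applyPauli_insert_left [DecidableEq ι] {A : Finset ι} {i : ι} (hi : i ∉ A)
    (f : (ι → Bool) → ℂ) :
    applyPauli (insert i A) ∅ f = applyPauli {i} ∅ (applyPauli A ∅ f) := by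
  have hflip (x : ι → Bool) : flipBits (insert i A) x = flipBits A (flipBits {i} x) := by
    funext j
    by_cases hj : j = i
    · simp [flipBits, hj, hi]
    · simp [flipBits, hj]
  funext x
  simp [applyPauli, hflip]

theorem applyPauli_insert_right [DecidableEq ι] (A : Finset ι) {B : Finset ι} {i : ι} (hi : i ∉ B)
    (f : (ι → Bool) → ℂ) :
    applyPauli A (insert i B) f = applyPauli ∅ {i} (applyPauli A B f) := by
  funext x
  simp [applyPauli, flipBits_empty, hi, mul_assoc]

end ApplyPauli

section Contract

variable {ι κ : Type} [Fintype ι] [DecidableEq ι] {f f' : (ι ⊕ κ → Bool) → ℂ}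
  {g g' : (ι → Bool) → ℂ}

/-- The contraction of two tensors along the wires labelled by `ι`. -/
noncomputable def contract (f : (ι ⊕ κ → Bool) → ℂ) (g : (ι → Bool) → ℂ) : (κ → Bool) → ℂ :=
  fun y => ∑ z, f (Sum.elim z y) * g z

theorem EqUpToScalar.contract_left (h : EqUpToScalar f f') (g : (ι → Bool) → ℂ) :
    EqUpToScalar (contract f g) (contract f' g) := by
  obtain ⟨c, hc, rfl⟩ := h
  refine ⟨c, hc, funext fun y => ?_⟩
  simp [contract, Finset.mul_sum, mul_assoc]

theorem EqUpToScalar.contract_right (f : (ι ⊕ κ → Bool) → ℂ) (h : EqUpToScalar g g') :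
    EqUpToScalar (contract f g) (contract f g') := by
  obtain ⟨c, hc, rfl⟩ := h
  refine ⟨c, hc, funext fun y => ?_⟩
  simp [contract, Finset.mul_sum, mul_left_comm]

theorem contract_zero (f : (ι ⊕ κ → Bool) → ℂ) : contract f 0 = 0 := by
  funext y
  simp [contract]

-- The scalar is the sign `(-1) ^ #(A ∩ B)` from moving the Z operators past the X operators.
theorem eqUpToScalar_contract_applyPauli (A B : Finset ι) (f : (ι ⊕ κ → Bool) → ℂ)
    (g : (ι → Bool) → ℂ) :
    EqUpToScalar (contract f (applyPauli A B g))
      (contract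
        (applyPauli (A.map Function.Embedding.inl) (B.map Function.Embedding.inl) f) g) := by
  refine ⟨∏ j ∈ B, boolSign (decide (j ∈ A)),
    Finset.prod_ne_zero_iff.mpr fun _ _ => boolSign_ne_zero _, funext fun y => ?_⟩
  have hsign (z : ι → Bool) : ∏ j ∈ B, boolSign (flipBits A z j) =
      (∏ j ∈ B, boolSign (decide (j ∈ A))) * ∏ j ∈ B, boolSign (z j) := by
    rw [← Finset.prod_mul_distrib]
    refine Finset.prod_congr rfl fun j _ => ?_
    rw [← boolSign_xor, Bool.xor_comm]
    by_cases hj : j ∈ A <;> simp [flipBits, hj]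
  calc contract f (applyPauli A B g) y
      = ∑ z, f (Sum.elim (flipBits A z) y) * applyPauli A B g (flipBits A z) :=
        ((flipBits_involutive A).bijective.sum_comp
          fun z => f (Sum.elim z y) * applyPauli A B g z).symm
    _ = _ := by
        simp only [contract, applyPauli, hsign, flipBits_involutive A _, flipBits_map_inl_elim,
          Finset.prod_map, Function.Embedding.inl_apply, Sum.elim_inl, Pi.smul_apply, smul_eq_mul,
          Finset.mul_sum]
        exact Finset.sum_congr rfl fun z _ => by ring

end Contract

namespace ZXDiagram

variable {ι κ : Type}

section Boundary

variable (D : ZXDiagram ι)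

/-- The half-edge attached to the boundary node `i`. -/
noncomputable def boundaryHalf (i : ι) : D.Edge × Bool := (D.boundary_degree i).choose

theorem attach_boundaryHalf (i : ι) : D.attach (D.boundaryHalf i) = Sum.inr i :=
  (D.boundary_degree i).choose_spec.1

theorem eq_boundaryHalf {i : ι} {h : D.Edge × Bool} (hh : D.attach h = Sum.inr i) :
    h = D.boundaryHalf i :=
  (D.boundary_degree i).unique hh (D.attach_boundaryHalf i)

theorem boundaryHalf_injective : Function.Injective D.boundaryHalf := fun i j h => by
  simpa [D.attach_boundaryHalf] using congrArg D.attach h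

end Boundary

section NodeTensor

theorem mem_legs {D : ZXDiagram ι} {v : D.Node} {h : D.Edge × Bool} :
    h ∈ D.legs v ↔ D.attach h = Sum.inl v := by
  simp [legs]

theorem card_legs (D : ZXDiagram ι) (v : D.Node) :
    (D.legs v).card = Nat.card {h // D.attach h = Sum.inl v} :=
  (Nat.subtype_card _ fun _ => mem_legs).symm

theorem nodeTensor_eq_of_injOn_legs {D : ZXDiagram ι} {D' : ZXDiagram κ} {v : D.Node}
    {v' : D'.Node} (hkind : D'.kind v' = D.kind v) (hphase : D'.phase v' = D.phase v)
    (hdegree : Nat.card {h // D'.attach h = Sum.inl v'} = Nat.card {h // D.attach h = Sum.inl v})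
    {φ : D.Edge × Bool → D'.Edge × Bool} (hmaps : Set.MapsTo φ (D.legs v) (D'.legs v'))
    (hinj : Set.InjOn φ (D.legs v)) {s : D.Edge × Bool → Bool} {s' : D'.Edge × Bool → Bool}
    (hs : ∀ h ∈ D.legs v, s' (φ h) = s h) : D'.nodeTensor v' s' = D.nodeTensor v s := by
  have hsurj : Set.SurjOn φ (D.legs v) (D'.legs v') :=
    Finset.surjOn_of_injOn_of_card_le φ hmaps hinj (by rw [card_legs, card_legs, hdegree])
  have hprod (f : Bool → ℂ) : ∏ h ∈ D'.legs v', f (s' h) = ∏ h ∈ D.legs v, f (s h) :=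
    (Finset.prod_nbij φ hmaps hinj hsurj fun h hh => by rw [hs h hh]).symm
  have hall : (∀ h ∈ D'.legs v', s' h = true) ↔ ∀ h ∈ D.legs v, s h = true := by
    refine ⟨fun hall h hh => (hs h hh).symm.trans (hall _ (hmaps hh)), fun hall h' hh' => ?_⟩
    obtain ⟨h, hh, rfl⟩ := hsurj hh'
    exact (hs h hh).trans (hall h hh)
  unfold nodeTensor
  rw [hkind, hphase]
  cases D.kind v <;> simp only [hprod, hall]

theorem nodeTensor_congr (D : ZXDiagram ι) (v : D.Node) {s s' : D.Edge × Bool → Bool}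
    (hs : ∀ h ∈ D.legs v, s' h = s h) : D.nodeTensor v s' = D.nodeTensor v s :=
  nodeTensor_eq_of_injOn_legs rfl rfl rfl (Set.mapsTo_id _) (Set.injOn_id _) hs

theorem nodeTensor_of_phaseFree_Z (D : ZXDiagram ι) {v : D.Node} (hkind : D.kind v = NodeKind.Z)
    (hphase : D.phase v = 0) (s : D.Edge × Bool → Bool) :
    D.nodeTensor v s = ∑ b, ∏ h ∈ D.legs v, if s h = b then (1 : ℂ) else 0 := by
  have hzero (b : Bool) : ketZero b = if b = false then 1 else 0 := by cases b <;> simp [ketZero]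
  have hone (b : Bool) : ketOne b = if b = true then 1 else 0 := by cases b <;> simp [ketOne]
  simp only [nodeTensor, hkind, hphase, hzero, hone, Fintype.sum_bool, ZMod.val_zero, pow_zero,
    one_mul]
  exact add_comm _ _

end NodeTensor

section Amplitude

variable (D : ZXDiagram ι) (F : D.Error)

open Classical in
theorem edgeOperator_apply (e : D.Edge) (a b : Bool) :
    D.edgeOperator F e a b =
      if a = (b ^^ decide ((e, FlipKind.X) ∈ F)) then
        boolSign (b && decide ((e, FlipKind.Z) ∈ F)) else 0 := by
  unfold edgeOperator
  by_cases hX : (e, FlipKind.X) ∈ F <;> by_cases hZ : (e, FlipKind.Z) ∈ F <;>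
    cases a <;> cases b <;>
    simp [hX, hZ, pauliX, pauliZ, boolSign, Matrix.mul_apply, Matrix.one_apply]

theorem edgeOperator_of_notMem {e : D.Edge} (he : ∀ t, (e, t) ∉ F) : D.edgeOperator F e = 1 := by
  simp [edgeOperator, he]

/-- The contribution of the half-edge labelling `s` to the contraction of `D + F`. -/
noncomputable def amplitude (s : D.Edge × Bool → Bool) : ℂ :=
  (∏ v, D.nodeTensor v s) * ∏ e, D.edgeOperator F e (s (e, false)) (s (e, true))

open Classical in
theorem interp_eq_sum_amplitude (x : ι → Bool) :
    D.interp F x = ∑ s, if s ∘ D.boundaryHalf = x then D.amplitude F s else 0 := by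
  refine Finset.sum_congr rfl fun s _ => ?_
  have hs : (∀ h i, D.attach h = Sum.inr i → s h = x i) ↔ s ∘ D.boundaryHalf = x := by
    refine ⟨fun hs => funext fun i => hs _ i (D.attach_boundaryHalf i), ?_⟩
    rintro rfl h i hh
    rw [D.eq_boundaryHalf hh, Function.comp_apply]
  simp only [hs, mul_ite, mul_one, mul_zero, amplitude]

open Classical in
theorem prod_edgeOperator_symmDiff_X (h : D.Edge × Bool) (s : D.Edge × Bool → Bool) :
    ∏ e, D.edgeOperator (symmDiff F {(h.1, FlipKind.X)}) e (s (e, false)) (s (e, true)) =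
      boolSign (h.2 && decide ((h.1, FlipKind.Z) ∈ F)) *
        ∏ e, D.edgeOperator F e (flipBits {h} s (e, false)) (flipBits {h} s (e, true)) := by
  obtain ⟨e, b⟩ := h
  rw [← Finset.mul_prod_erase _ _ (Finset.mem_univ e),
    ← Finset.mul_prod_erase _ _ (Finset.mem_univ e), ← mul_assoc]
  congr 1
  · simp only [edgeOperator_apply, flipBits, Finset.mem_symmDiff, Finset.mem_singleton]
    by_cases hX : (e, FlipKind.X) ∈ F <;> by_cases hZ : (e, FlipKind.Z) ∈ F <;>
      cases s (e, false) <;> cases s (e, true) <;> cases b <;> simp [hX, hZ, boolSign]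
  · refine Finset.prod_congr rfl fun e' he' => ?_
    simp [edgeOperator_apply, flipBits, Finset.mem_symmDiff, Finset.ne_of_mem_erase he']

open Classical in
theorem prod_edgeOperator_symmDiff_Z (h : D.Edge × Bool) (s : D.Edge × Bool → Bool) :
    ∏ e, D.edgeOperator (symmDiff F {(h.1, FlipKind.Z)}) e (s (e, false)) (s (e, true)) =
      boolSign (!h.2 && decide ((h.1, FlipKind.X) ∈ F)) * boolSign (s h) *
        ∏ e, D.edgeOperator F e (s (e, false)) (s (e, true)) := by
  obtain ⟨e, b⟩ := h
  rw [← Finset.mul_prod_erase _ _ (Finset.mem_univ e),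
    ← Finset.mul_prod_erase _ _ (Finset.mem_univ e), ← mul_assoc]
  congr 1
  · simp only [edgeOperator_apply, Finset.mem_symmDiff, Finset.mem_singleton]
    by_cases hX : (e, FlipKind.X) ∈ F <;> by_cases hZ : (e, FlipKind.Z) ∈ F <;>
      cases hf : s (e, false) <;> cases ht : s (e, true) <;> cases b <;>
      simp [hX, hZ, boolSign, hf, ht]
  · refine Finset.prod_congr rfl fun e' he' => ?_
    simp [edgeOperator_apply, Finset.mem_symmDiff, Finset.ne_of_mem_erase he']

theorem nodeTensor_flipBits_boundaryHalf (v : D.Node) (i : ι) (s : D.Edge × Bool → Bool) :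
    D.nodeTensor v (flipBits {D.boundaryHalf i} s) = D.nodeTensor v s := by
  refine D.nodeTensor_congr v fun h hh => ?_
  have hne : h ≠ D.boundaryHalf i := by
    rintro rfl
    simp [mem_legs, D.attach_boundaryHalf] at hh
  simp [flipBits, hne]

end Amplitude

section AbsorbPauli

variable (D : ZXDiagram ι)

open Classical in
theorem eqUpToScalar_interp_symmDiff_X (F : D.Error) (i : ι) :
    EqUpToScalar (D.interp (symmDiff F {((D.boundaryHalf i).1, FlipKind.X)}))
      (applyPauli {i} ∅ (D.interp F)) := by
  refine ⟨_, boolSign_ne_zero ((D.boundaryHalf i).2 &&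
    decide (((D.boundaryHalf i).1, FlipKind.Z) ∈ F)), funext fun x => ?_⟩
  have hboundary (s : D.Edge × Bool → Bool) :
      s ∘ D.boundaryHalf = x ↔
        flipBits {D.boundaryHalf i} s ∘ D.boundaryHalf = flipBits {i} x := by
    have h := flipBits_map_comp ⟨_, D.boundaryHalf_injective⟩ {i} s
    rw [Finset.map_singleton] at h
    exact (flipBits_involutive {i}).injective.eq_iff.symm.trans (Eq.congr_left h.symm)
  simp only [applyPauli, Pi.smul_apply, smul_eq_mul, Finset.prod_empty, one_mul,
    interp_eq_sum_amplitude, Finset.mul_sum]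
  refine Fintype.sum_equiv (flipBits_involutive {D.boundaryHalf i}).toPerm _ _ fun s => ?_
  simp only [Function.Involutive.coe_toPerm, hboundary s, amplitude,
    D.prod_edgeOperator_symmDiff_X, D.nodeTensor_flipBits_boundaryHalf, mul_ite, mul_zero,
    mul_left_comm]

open Classical in
theorem eqUpToScalar_interp_symmDiff_Z (F : D.Error) (i : ι) :
    EqUpToScalar (D.interp (symmDiff F {((D.boundaryHalf i).1, FlipKind.Z)}))
      (applyPauli ∅ {i} (D.interp F)) := by
  refine ⟨_, boolSign_ne_zero (!(D.boundaryHalf i).2 &&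
    decide (((D.boundaryHalf i).1, FlipKind.X) ∈ F)), funext fun x => ?_⟩
  simp only [applyPauli, Pi.smul_apply, smul_eq_mul, Finset.prod_singleton, flipBits_empty,
    interp_eq_sum_amplitude, Finset.mul_sum]
  refine Finset.sum_congr rfl fun s _ => ?_
  split_ifs with hs
  · simp only [amplitude, D.prod_edgeOperator_symmDiff_Z, ← hs, Function.comp_apply]
    ring
  · simp

open Classical in
theorem image_fst_symmDiff_singleton_subset (F : D.Error) (e : D.Edge) (t : FlipKind) :
    (symmDiff F {(e, t)}).image Prod.fst ⊆ insert e (F.image Prod.fst) := by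
  intro e' he'
  simp only [Finset.mem_image, Finset.mem_symmDiff, Finset.mem_singleton] at he'
  obtain ⟨p, ⟨hp, -⟩ | ⟨rfl, -⟩, rfl⟩ := he'
  · exact Finset.mem_insert_of_mem (Finset.mem_image_of_mem _ hp)
  · exact Finset.mem_insert_self _ _

theorem exists_interp_eqUpToScalar_applyPauli [DecidableEq ι] (F : D.Error) (A B : Finset ι) :
    ∃ F' : D.Error,
      F'.image Prod.fst ⊆ (A ∪ B).image (fun i => (D.boundaryHalf i).1) ∪ F.image Prod.fst ∧
      EqUpToScalar (D.interp F') (applyPauli A B (D.interp F)) := by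
  classical
  induction B using Finset.induction_on with
  | empty =>
    induction A using Finset.induction_on with
    | empty => exact ⟨F, by simp, by rw [applyPauli_empty]; exact EqUpToScalar.refl _⟩
    | insert i A hi ih =>
      obtain ⟨F', hsub, heq⟩ := ih
      refine ⟨_, (D.image_fst_symmDiff_singleton_subset F' _ _).trans ?_,
        applyPauli_insert_left hi (D.interp F) ▸
          (D.eqUpToScalar_interp_symmDiff_X F' i).trans (heq.applyPauli _ _)⟩
      rw [Finset.insert_union, Finset.image_insert, Finset.insert_union]
      exact Finset.insert_subset_insert _ hsub
  | insert i B hi ih =>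
    obtain ⟨F', hsub, heq⟩ := ih
    refine ⟨_, (D.image_fst_symmDiff_singleton_subset F' _ _).trans ?_,
      applyPauli_insert_right A hi (D.interp F) ▸
        (D.eqUpToScalar_interp_symmDiff_Z F' i).trans (heq.applyPauli _ _)⟩
    rw [Finset.union_insert, Finset.image_insert, Finset.insert_union]
    exact Finset.insert_subset_insert _ hsub

theorem exists_weight_le_and_eqUpToScalar_applyPauli [DecidableEq ι] (F : D.Error)
    (A B : Finset ι) :
    ∃ F' : D.Error, D.weight F' ≤ (A ∪ B).card + D.weight F ∧
      EqUpToScalar (D.interp F') (applyPauli A B (D.interp F)) := by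
  obtain ⟨F', hsub, heq⟩ := D.exists_interp_eqUpToScalar_applyPauli F A B
  exact ⟨F', (Finset.card_le_card hsub).trans ((Finset.card_union_le _ _).trans
    (Nat.add_le_add_right Finset.card_image_le _)), heq⟩

end AbsorbPauli

open Classical in
theorem interp_of_phaseFree_Z (D : ZXDiagram ι) (hkind : ∀ v, D.kind v = NodeKind.Z)
    (hphase : ∀ v, D.phase v = 0) (F : D.Error) (x : ι → Bool) :
    D.interp F x = ∑ t : D.Node → Bool, ∏ e, D.edgeOperator F e
      (Sum.elim t x (D.attach (e, false))) (Sum.elim t x (D.attach (e, true))) := by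
  have hnodes (s : D.Edge × Bool → Bool) : ∏ v, D.nodeTensor v s =
      ∑ t : D.Node → Bool, if ∀ v, ∀ h ∈ D.legs v, s h = t v then (1 : ℂ) else 0 := by
    rw [Finset.prod_congr rfl fun v _ => D.nodeTensor_of_phaseFree_Z (hkind v) (hphase v) s,
      Finset.prod_univ_sum, Fintype.piFinset_univ]
    simp only [Finset.prod_ite_zero, Finset.prod_const_one, Finset.mem_univ, true_imp_iff]
  have hlabels (t : D.Node → Bool) (s : D.Edge × Bool → Bool) :
      ((∀ v, ∀ h ∈ D.legs v, s h = t v) ∧ ∀ h i, D.attach h = Sum.inr i → s h = x i) ↔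
        s = fun h => Sum.elim t x (D.attach h) := by
    simp only [mem_legs, funext_iff]
    refine ⟨fun ⟨hnode, hboundary⟩ h => ?_, fun hs => ⟨?_, ?_⟩⟩
    · rcases ha : D.attach h with v | i
      · exact hnode v h ha
      · exact hboundary h i ha
    · exact fun v h ha => by rw [hs, ha, Sum.elim_inl]
    · exact fun h i ha => by rw [hs, ha, Sum.elim_inr]
  simp only [interp, hnodes, Finset.sum_mul]
  rw [Finset.sum_comm]
  refine Finset.sum_congr rfl fun t _ => ?_
  simp only [ite_mul, one_mul, zero_mul, mul_ite, mul_one, mul_zero, ← ite_and]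
  simp only [and_comm, hlabels, Finset.sum_ite_eq', Finset.mem_univ, if_true]

theorem distance_le_distance {D D' : ZXDiagram κ}
    (hinterp : EqUpToScalar (D'.interp ∅) (D.interp ∅))
    (herror : ∀ F, D'.interp F = 0 ∨
      ∃ F', D.weight F' ≤ D'.weight F ∧ EqUpToScalar (D'.interp F) (D.interp F')) :
    D.distance ≤ D'.distance := by
  refine le_iInf₂ fun F ⟨hnontrivial, hundetectable⟩ => ?_
  obtain ⟨F', hweight, heq⟩ := (herror F).resolve_left hundetectable
  have hF' : ¬ D.IsTrivial F' ∧ ¬ D.IsDetectable F' := by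
    refine ⟨fun ht => hnontrivial (heq.trans (ht.trans hinterp.symm)), fun hd => hundetectable ?_⟩
    obtain ⟨c, -, hc⟩ := heq
    rw [IsDetectable, hc, hd, smul_zero]
  exact (iInf₂_le F' hF').trans (Nat.cast_le.mpr hweight)

end ZXDiagram

namespace ZXPattern

variable {ι κ : Type}

section InternalEdges

variable (P : ZXPattern ι)

theorem attach_not_boundaryHalf (i : ι) :
    P.attach ((P.boundaryHalf i).1, !(P.boundaryHalf i).2) = Sum.inl (P.neighbour i) := by
  obtain ⟨e, b, hi, hv⟩ := P.neighbour_spec i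
  rwa [← P.eq_boundaryHalf hi]

theorem fst_boundaryHalf_injective : Function.Injective fun i => (P.boundaryHalf i).1 := by
  intro i j (hij : (P.boundaryHalf i).1 = (P.boundaryHalf j).1)
  by_contra hne
  have hsnd : (P.boundaryHalf j).2 = !(P.boundaryHalf i).2 :=
    Bool.eq_not.mpr fun h => hne (P.boundaryHalf_injective (Prod.ext hij h.symm))
  have hj := P.attach_not_boundaryHalf i
  rw [← hsnd, hij, Prod.mk.eta, P.attach_boundaryHalf] at hj
  cases hj

theorem coe_internalEdge_ne_fst_boundaryHalf (e : P.InternalEdge) (i : ι) :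
    e.1 ≠ (P.boundaryHalf i).1 := by
  intro h
  simpa [h, P.attach_boundaryHalf] using e.2 (P.boundaryHalf i).2

theorem exists_internalEdge_or_exists_boundaryHalf (e : P.Edge) :
    (∃ e' : P.InternalEdge, e'.1 = e) ∨ ∃ i, (P.boundaryHalf i).1 = e := by
  refine or_iff_not_imp_left.mpr fun he => ?_
  have hb : ¬ ∀ b, (P.attach (e, b)).isLeft = true := fun hb => he ⟨⟨e, hb⟩, rfl⟩
  push Not at hb
  obtain ⟨b, hb⟩ := hb
  obtain ⟨i, hi⟩ := Sum.isRight_iff.mp (Sum.not_isLeft.mp hb)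
  exact ⟨i, by rw [← P.eq_boundaryHalf hi]⟩

/-- Every edge of a pattern is either internal or the edge of exactly one boundary node. -/
noncomputable def edgeEquiv : P.InternalEdge ⊕ ι ≃ P.Edge :=
  Equiv.ofBijective (Sum.elim Subtype.val fun i => (P.boundaryHalf i).1)
    ⟨Subtype.val_injective.sumElim P.fst_boundaryHalf_injective
      P.coe_internalEdge_ne_fst_boundaryHalf, fun e => by
        obtain ⟨e', he⟩ | ⟨i, hi⟩ := P.exists_internalEdge_or_exists_boundaryHalf e
        · exact ⟨Sum.inl e', he⟩
        · exact ⟨Sum.inr i, hi⟩⟩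

theorem edgeEquiv_symm_internalEdge (e : P.InternalEdge) : P.edgeEquiv.symm e.1 = Sum.inl e :=
  P.edgeEquiv.symm_apply_apply (Sum.inl e)

theorem edgeEquiv_symm_boundaryHalf (i : ι) :
    P.edgeEquiv.symm (P.boundaryHalf i).1 = Sum.inr i :=
  P.edgeEquiv.symm_apply_apply (Sum.inr i)

/-- An error is internal if it has no flip on the edges that end in a boundary node. -/
def IsInternal (G : P.Error) : Prop := ∀ i t, ((P.boundaryHalf i).1, t) ∉ G

/-- The labelling of the half-edges with the labels `z` on both halves of the boundary edges and
the labels `σ` on the halves of the internal edges. -/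
noncomputable def extendLabels (z : ι → Bool) (σ : P.InternalEdge × Bool → Bool) :
    P.Edge × Bool → Bool :=
  fun h => Sum.elim (fun e => σ (e, h.2)) z (P.edgeEquiv.symm h.1)

theorem extendLabels_internalEdge (z : ι → Bool) (σ : P.InternalEdge × Bool → Bool)
    (e : P.InternalEdge) (b : Bool) : P.extendLabels z σ (e.1, b) = σ (e, b) := by
  simp only [extendLabels, edgeEquiv_symm_internalEdge, Sum.elim_inl]

theorem extendLabels_boundaryHalf (z : ι → Bool) (σ : P.InternalEdge × Bool → Bool) (i : ι)
    (b : Bool) : P.extendLabels z σ ((P.boundaryHalf i).1, b) = z i := by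
  simp only [extendLabels, edgeEquiv_symm_boundaryHalf, Sum.elim_inr]

theorem extendLabels_injective (z : ι → Bool) : Function.Injective (P.extendLabels z) :=
  fun σ σ' h => funext fun ⟨e, b⟩ => by
    simpa only [extendLabels_internalEdge] using congrFun h (e.1, b)

variable {P} {G : P.Error}

theorem eq_extendLabels_of_amplitude_ne_zero (hG : P.IsInternal G) {s : P.Edge × Bool → Bool}
    (hs : P.amplitude G s ≠ 0) :
    s = P.extendLabels (s ∘ P.boundaryHalf) fun h => s (h.1.1, h.2) := by
  funext ⟨e, b⟩
  obtain ⟨e, rfl⟩ | ⟨i, rfl⟩ := P.exists_internalEdge_or_exists_boundaryHalf e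
  · rw [extendLabels_internalEdge]
  · have hop := Finset.prod_ne_zero_iff.mp (right_ne_zero_of_mul hs) (P.boundaryHalf i).1
      (Finset.mem_univ _)
    rw [P.edgeOperator_of_notMem G (hG i), Matrix.one_apply] at hop
    have heq (c : Bool) : s ((P.boundaryHalf i).1, c) = s ((P.boundaryHalf i).1, false) := by
      cases c
      · rfl
      · exact (ite_ne_right_iff.mp hop).1.symm
    rw [extendLabels_boundaryHalf]
    exact (heq b).trans (heq (P.boundaryHalf i).2).symm

theorem interp_eq_sum_extendLabels (hG : P.IsInternal G) (z : ι → Bool) :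
    P.interp G z = ∑ σ, P.amplitude G (P.extendLabels z σ) := by
  classical
  rw [P.interp_eq_sum_amplitude]
  refine (Fintype.sum_of_injective _ (P.extendLabels_injective z) _ _ (fun s hs => ?_)
    fun σ => ?_).symm
  · refine ite_eq_right_iff.mpr fun hz => by_contra fun hne => hs ?_
    exact ⟨_, hz ▸ (eq_extendLabels_of_amplitude_ne_zero hG hne).symm⟩
  · exact (if_pos (funext fun i => P.extendLabels_boundaryHalf z σ i _)).symm

end InternalEdges

section PlugErrors

variable (C : ZXDiagram (ι ⊕ κ)) (P : ZXPattern ι)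

/-- The part of an error on a plugged diagram that lies on the edges of the context. -/
def contextError (F : (plug C P).Error) : C.Error :=
  (F.map (Equiv.sumProdDistrib C.Edge P.InternalEdge FlipKind).toEmbedding).toLeft

/-- The part of an error on a plugged diagram that lies on the internal edges of the pattern. -/
def patternError (F : (plug C P).Error) : P.Error :=
  (F.map (Equiv.sumProdDistrib C.Edge P.InternalEdge FlipKind).toEmbedding).toRight.map
    ((Function.Embedding.subtype _).prodMap (Function.Embedding.refl _))

/-- An error on the context, as an error on a plugged diagram. -/
def liftError (E : C.Error) : (plug C P).Error :=
  E.map (Function.Embedding.inl.prodMap (Function.Embedding.refl _))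

variable {C P} {F : (plug C P).Error}

theorem mem_contextError {e : C.Edge} {t : FlipKind} :
    (e, t) ∈ contextError C P F ↔ (Sum.inl e, t) ∈ F := by
  simp [contextError]

theorem mem_patternError {e : P.InternalEdge} {t : FlipKind} :
    (e.1, t) ∈ patternError C P F ↔ (Sum.inr e, t) ∈ F := by
  simp only [patternError, Finset.mem_map, Finset.mem_toRight, Function.Embedding.prodMap,
    Equiv.toEmbedding_apply, Function.Embedding.coeFn_mk, Prod.map,
    Function.Embedding.subtype_apply, Function.Embedding.refl_apply, Prod.exists]
  simp [← Subtype.ext_iff]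

theorem isInternal_patternError (F : (plug C P).Error) : P.IsInternal (patternError C P F) := by
  intro i t h
  obtain ⟨⟨e, t'⟩, -, he⟩ := Finset.mem_map.mp h
  exact P.coe_internalEdge_ne_fst_boundaryHalf e i (congrArg Prod.fst he)

theorem weight_contextError_add_weight_patternError_le (F : (plug C P).Error) :
    C.weight (contextError C P F) + P.weight (patternError C P F) ≤ (plug C P).weight F := by
  classical
  unfold ZXDiagram.weight
  rw [← Finset.card_toLeft_add_card_toRight (u := F.image Prod.fst),
    ← Finset.card_map (Function.Embedding.subtype _) (s := (F.image Prod.fst).toRight)]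
  refine Nat.add_le_add (Finset.card_le_card fun e he => ?_) (Finset.card_le_card fun e he => ?_)
  · obtain ⟨⟨e, t⟩, h, rfl⟩ := Finset.mem_image.mp he
    exact Finset.mem_toLeft.mpr (Finset.mem_image_of_mem Prod.fst (mem_contextError.mp h))
  · obtain ⟨p, hp, rfl⟩ := Finset.mem_image.mp he
    obtain ⟨⟨e, t⟩, -, rfl⟩ := Finset.mem_map.mp hp
    exact Finset.mem_map_of_mem _
      (Finset.mem_toRight.mpr (Finset.mem_image_of_mem Prod.fst (mem_patternError.mp hp)))

theorem contextError_liftError (E : C.Error) : contextError C P (liftError C P E) = E := by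
  ext ⟨e, t⟩
  simp [mem_contextError, liftError]

theorem patternError_liftError (E : C.Error) : patternError C P (liftError C P E) = ∅ := by
  simp [patternError, liftError, Finset.eq_empty_iff_forall_notMem]

theorem weight_liftError (E : C.Error) : (plug C P).weight (liftError C P E) = C.weight E := by
  classical
  unfold ZXDiagram.weight liftError
  rw [Finset.map_eq_image, Finset.image_image,
    ← Finset.card_image_of_injective (E.image Prod.fst) (Sum.inl_injective (β := P.InternalEdge)),
    Finset.image_image]
  rfl

end PlugErrors

section Plug

variable (C : ZXDiagram (ι ⊕ κ)) (P : ZXPattern ι)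

theorem boundaryHalf_plug (k : κ) :
    (plug C P).boundaryHalf k =
      (Sum.inl (C.boundaryHalf (Sum.inr k)).1, (C.boundaryHalf (Sum.inr k)).2) := by
  refine ((plug C P).eq_boundaryHalf ?_).symm
  simp only [plugAttach_inl_eq, C.attach_boundaryHalf]

theorem nodeTensor_plug_inl (v : C.Node) (s : (plug C P).Edge × Bool → Bool) :
    (plug C P).nodeTensor (Sum.inl v) s = C.nodeTensor v fun h => s (Sum.inl h.1, h.2) := by
  refine ZXDiagram.nodeTensor_eq_of_injOn_legs (D := C) (D' := plug C P) rfl rfl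
    (plugAttach_card_left C P v) (φ := fun h => (Sum.inl h.1, h.2)) (fun h hh => ?_)
    (fun h _ h' _ heq => ?_) fun _ _ => rfl
  · refine ZXDiagram.mem_legs.mpr ((plugAttach_inl_eq C P h).trans ?_)
    rw [ZXDiagram.mem_legs.mp hh]
  · simpa [Prod.ext_iff] using heq

/-- The half-edge of the plugged diagram at the same node of the pattern. For a boundary edge of
the pattern this is the half-edge of the context at the port. -/
noncomputable def plugHalf (h : P.Edge × Bool) : (plug C P).Edge × Bool :=
  Sum.elim (fun e => (Sum.inr e, h.2))
    (fun i => (Sum.inl (C.boundaryHalf (Sum.inl i)).1, (C.boundaryHalf (Sum.inl i)).2))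
    (P.edgeEquiv.symm h.1)

theorem plugHalf_internalEdge (e : P.InternalEdge) (b : Bool) :
    plugHalf C P (e.1, b) = (Sum.inr e, b) := by
  simp only [plugHalf, edgeEquiv_symm_internalEdge, Sum.elim_inl]

theorem plugHalf_boundaryHalf (i : ι) (b : Bool) :
    plugHalf C P ((P.boundaryHalf i).1, b) =
      (Sum.inl (C.boundaryHalf (Sum.inl i)).1, (C.boundaryHalf (Sum.inl i)).2) := by
  simp only [plugHalf, edgeEquiv_symm_boundaryHalf, Sum.elim_inr]

theorem eq_not_of_attach_boundaryHalf {i : ι} {b : Bool} {v : P.Node}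
    (h : P.attach ((P.boundaryHalf i).1, b) = Sum.inl v) : b = !(P.boundaryHalf i).2 := by
  refine Bool.eq_not.mpr ?_
  rintro rfl
  rw [Prod.mk.eta, P.attach_boundaryHalf] at h
  cases h

theorem mapsTo_plugHalf (v : P.Node) :
    Set.MapsTo (plugHalf C P) (P.legs v) ((plug C P).legs (Sum.inr v)) := by
  rintro ⟨e, b⟩ h
  have hv := ZXDiagram.mem_legs.mp h
  refine ZXDiagram.mem_legs.mpr ?_
  obtain ⟨e, rfl⟩ | ⟨i, rfl⟩ := P.exists_internalEdge_or_exists_boundaryHalf e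
  · rw [plugHalf_internalEdge]
    simp [plugAttach, hv]
  · rw [eq_not_of_attach_boundaryHalf P hv, attach_not_boundaryHalf, Sum.inl.injEq] at hv
    rw [plugHalf_boundaryHalf]
    simp only [plugAttach_inl_eq, C.attach_boundaryHalf, hv]

theorem injOn_plugHalf (v : P.Node) : Set.InjOn (plugHalf C P) (P.legs v) := by
  rintro ⟨e, b⟩ h ⟨e', b'⟩ h' heq
  have hv := ZXDiagram.mem_legs.mp h
  have hv' := ZXDiagram.mem_legs.mp h'
  obtain ⟨e, rfl⟩ | ⟨i, rfl⟩ := P.exists_internalEdge_or_exists_boundaryHalf e <;>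
    obtain ⟨e', rfl⟩ | ⟨i', rfl⟩ := P.exists_internalEdge_or_exists_boundaryHalf e'
  · simpa [plugHalf_internalEdge, Subtype.ext_iff] using heq
  · simp [plugHalf_internalEdge, plugHalf_boundaryHalf] at heq
  · simp [plugHalf_internalEdge, plugHalf_boundaryHalf] at heq
  · have hport : C.boundaryHalf (Sum.inl i) = C.boundaryHalf (Sum.inl i') := by
      simpa [plugHalf_boundaryHalf, Prod.ext_iff] using heq
    obtain rfl : i = i' := Sum.inl_injective (C.boundaryHalf_injective hport)
    rw [eq_not_of_attach_boundaryHalf P hv, eq_not_of_attach_boundaryHalf P hv']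

theorem nodeTensor_plug_inr (v : P.Node) (s : (plug C P).Edge × Bool → Bool) :
    (plug C P).nodeTensor (Sum.inr v) s = P.nodeTensor v (s ∘ plugHalf C P) :=
  ZXDiagram.nodeTensor_eq_of_injOn_legs (D := P.toZXDiagram) (D' := plug C P) rfl rfl
    (plugAttach_card_right C P v) (mapsTo_plugHalf C P v) (injOn_plugHalf C P v) fun _ _ => rfl

theorem prod_edgeOperator_plug (F : (plug C P).Error) (s : (plug C P).Edge × Bool → Bool) :
    ∏ e, (plug C P).edgeOperator F e (s (e, false)) (s (e, true)) =
      (∏ e, C.edgeOperator (contextError C P F) e (s (Sum.inl e, false)) (s (Sum.inl e, true))) *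
      ∏ e, P.edgeOperator (patternError C P F) e (s (plugHalf C P (e, false)))
        (s (plugHalf C P (e, true))) := by
  classical
  have hcontext (e : C.Edge) :
      (plug C P).edgeOperator F (Sum.inl e) = C.edgeOperator (contextError C P F) e := by
    simp only [ZXDiagram.edgeOperator, mem_contextError]
  have hpattern (e : P.InternalEdge) :
      (plug C P).edgeOperator F (Sum.inr e) = P.edgeOperator (patternError C P F) e.1 := by
    simp only [ZXDiagram.edgeOperator, mem_patternError]
  have hboundary (e : P.Edge) (he : e ∉ Set.range (Subtype.val : P.InternalEdge → P.Edge)) :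
      P.edgeOperator (patternError C P F) e (s (plugHalf C P (e, false)))
        (s (plugHalf C P (e, true))) = 1 := by
    obtain ⟨e', rfl⟩ | ⟨i, rfl⟩ := P.exists_internalEdge_or_exists_boundaryHalf e
    · exact absurd ⟨e', rfl⟩ he
    · rw [P.edgeOperator_of_notMem _ (isInternal_patternError F i), plugHalf_boundaryHalf,
        plugHalf_boundaryHalf, Matrix.one_apply_eq]
  have hinternal : ∏ e : P.InternalEdge, P.edgeOperator (patternError C P F) e.1
      (s (Sum.inr e, false)) (s (Sum.inr e, true)) =
      ∏ e, P.edgeOperator (patternError C P F) e (s (plugHalf C P (e, false)))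
        (s (plugHalf C P (e, true))) :=
    Fintype.prod_of_injective _ Subtype.val_injective _ _ hboundary
      fun e => by simp only [plugHalf_internalEdge]
  rw [Fintype.prod_sum_type, ← hinternal]
  simp only [hcontext, hpattern]

theorem amplitude_plug (F : (plug C P).Error) (s : (plug C P).Edge × Bool → Bool) :
    (plug C P).amplitude F s =
      C.amplitude (contextError C P F) (fun h => s (Sum.inl h.1, h.2)) *
        P.amplitude (patternError C P F) (s ∘ plugHalf C P) := by
  have hnodes : ∏ v, (plug C P).nodeTensor v s =
      (∏ v, C.nodeTensor v fun h => s (Sum.inl h.1, h.2)) *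
        ∏ v, P.nodeTensor v (s ∘ plugHalf C P) := by
    simp only [Fintype.prod_sum_type, nodeTensor_plug_inl, nodeTensor_plug_inr]
  rw [ZXDiagram.amplitude, hnodes, prod_edgeOperator_plug]
  exact mul_mul_mul_comm _ _ _ _

theorem comp_plugHalf (s : (plug C P).Edge × Bool → Bool) :
    s ∘ plugHalf C P =
      P.extendLabels ((fun h => s (Sum.inl h.1, h.2)) ∘ C.boundaryHalf ∘ Sum.inl)
        fun h => s (Sum.inr h.1, h.2) := by
  funext ⟨e, b⟩
  obtain ⟨e, rfl⟩ | ⟨i, rfl⟩ := P.exists_internalEdge_or_exists_boundaryHalf e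
  · rw [Function.comp_apply, plugHalf_internalEdge, extendLabels_internalEdge]
  · rw [Function.comp_apply, plugHalf_boundaryHalf, extendLabels_boundaryHalf]
    rfl

theorem interp_plug [Fintype ι] [DecidableEq ι] (F : (plug C P).Error) :
    (plug C P).interp F =
      contract (C.interp (contextError C P F)) (P.interp (patternError C P F)) := by
  classical
  funext y
  have hglue (s : C.Edge × Bool → Bool) (z : ι → Bool) :
      s ∘ C.boundaryHalf = Sum.elim z y ↔
        s ∘ C.boundaryHalf ∘ Sum.inl = z ∧ s ∘ C.boundaryHalf ∘ Sum.inr = y := by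
    simp [funext_iff]
  calc (plug C P).interp F y
      = ∑ p : (C.Edge × Bool → Bool) × (P.InternalEdge × Bool → Bool),
          if p.1 ∘ C.boundaryHalf ∘ Sum.inr = y then
            C.amplitude (contextError C P F) p.1 * P.amplitude (patternError C P F)
              (P.extendLabels (p.1 ∘ C.boundaryHalf ∘ Sum.inl) p.2)
          else 0 := by
        rw [ZXDiagram.interp_eq_sum_amplitude]
        refine Fintype.sum_equiv (((Equiv.sumProdDistrib _ _ _).arrowCongr (Equiv.refl _)).trans
          (Equiv.sumArrowEquivProdArrow _ _ _)) _ _ fun s => ?_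
        rw [amplitude_plug, comp_plugHalf, funext (boundaryHalf_plug C P)]
        rfl
    _ = contract (C.interp (contextError C P F)) (P.interp (patternError C P F)) y := by
        simp only [contract, interp_eq_sum_extendLabels (isInternal_patternError F),
          ZXDiagram.interp_eq_sum_amplitude, hglue, Fintype.sum_prod_type, Finset.sum_mul, ite_and,
          ite_mul, zero_mul]
        conv_rhs => rw [Finset.sum_comm]
        refine Finset.sum_congr rfl fun s _ => ?_
        simp only [Finset.sum_ite_eq, Finset.mem_univ, if_true]
        split_ifs <;> simp [Finset.mul_sum]

theorem interp_liftError [Fintype ι] [DecidableEq ι] (E : C.Error) :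
    (plug C P).interp (liftError C P E) = contract (C.interp E) (P.interp ∅) := by
  rw [interp_plug, contextError_liftError, patternError_liftError]

end Plug

theorem distanceNonDecreasing_of_applyPauli [Finite ι] [DecidableEq ι] {P Q : ZXPattern ι}
    (hinterp : EqUpToScalar (Q.interp ∅) (P.interp ∅))
    (hpauli : ∀ G : Q.Error, Q.IsInternal G → Q.interp G = 0 ∨ ∃ A B : Finset ι,
      (A ∪ B).card ≤ Q.weight G ∧ EqUpToScalar (Q.interp G) (applyPauli A B (P.interp ∅))) :
    DistanceNonDecreasing P Q := by
  classical
  have := Fintype.ofFinite ι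
  intro κ C
  refine ZXDiagram.distance_le_distance ?_ fun F => ?_
  · change EqUpToScalar ((plug C Q).interp (liftError C Q ∅)) ((plug C P).interp (liftError C P ∅))
    rw [interp_liftError, interp_liftError]
    exact hinterp.contract_right _
  rcases hpauli _ (isInternal_patternError F) with hzero | ⟨A, B, hcard, heq⟩
  · exact Or.inl (by rw [interp_plug, hzero, contract_zero])
  obtain ⟨E, hweight, hE⟩ := C.exists_weight_le_and_eqUpToScalar_applyPauli (contextError C Q F)
    (A.map Function.Embedding.inl) (B.map Function.Embedding.inl)
  refine Or.inr ⟨liftError C P E, ?_, ?_⟩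
  · rw [← Finset.map_union, Finset.card_map] at hweight
    have hsplit := weight_contextError_add_weight_patternError_le F
    rw [weight_liftError]
    omega
  · rw [interp_plug, interp_liftError]
    exact (heq.contract_right _).trans
      ((eqUpToScalar_contract_applyPauli A B _ _).trans (hE.symm.contract_left _))

end ZXPattern

section GHZ

variable {ι : Type}

open Classical in
/-- The tensor `|0…0⟩ + |1…1⟩` of a phase-free Z spider, for nonempty `ι`. -/
noncomputable def ghz : (ι → Bool) → ℂ := fun x => if ∀ i j, x i = x j then 1 else 0

theorem applyPauli_compl_ghz [Fintype ι] [DecidableEq ι] (A B : Finset ι) :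
    applyPauli Aᶜ B ghz = applyPauli A B ghz := by
  have hghz (x : ι → Bool) : ghz (flipBits Aᶜ x) = ghz (flipBits A x) := by
    unfold ghz
    congr 1
    simp only [flipBits_compl, Bool.not_inj_iff]
  funext x
  rw [applyPauli, applyPauli, hghz]

theorem eqUpToScalar_applyPauli_singleton_ghz (A : Finset ι) (j k : ι) :
    EqUpToScalar (applyPauli A {j} ghz) (applyPauli A {k} ghz) := by
  classical
  refine ⟨boolSign (decide (j ∈ A) ^^ decide (k ∈ A)), boolSign_ne_zero _, funext fun x => ?_⟩
  simp only [applyPauli, Finset.prod_singleton, Pi.smul_apply, smul_eq_mul, ghz]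
  split_ifs with hx
  · have hjk : flipBits A x j = flipBits A x k := hx j k
    rw [mul_one, mul_one, ← boolSign_xor]
    congr 1
    unfold flipBits at hjk
    revert hjk
    by_cases hj : j ∈ A <;> by_cases hk : k ∈ A <;> cases x j <;> cases x k <;> simp [hj, hk]
  · simp

theorem exists_card_union_singleton_le_and_eqUpToScalar_ghz [DecidableEq ι] (A : Finset ι)
    (k : ι) :
    ∃ j, (A ∪ {j}).card ≤ max A.card 1 ∧
      EqUpToScalar (applyPauli A {k} ghz) (applyPauli A {j} ghz) := by
  obtain rfl | ⟨j, hj⟩ := A.eq_empty_or_nonempty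
  · exact ⟨k, by simp, EqUpToScalar.refl _⟩
  · refine ⟨j, ?_, eqUpToScalar_applyPauli_singleton_ghz A k j⟩
    rw [Finset.union_eq_left.mpr (Finset.singleton_subset_iff.mpr hj)]
    exact le_max_left _ _

theorem ghz_eq_prod [Fintype ι] (x : ι → Bool) (k : ι) :
    ghz x = ∏ j, (1 : Matrix Bool Bool ℂ) (x k) (x j) := by
  simp only [ghz, Matrix.one_apply, Finset.prod_ite_zero, Finset.mem_univ, true_imp_iff,
    Finset.prod_const_one]
  exact ite_congr (propext ⟨fun h j => h k j, fun h i j => (h i).symm.trans (h j)⟩)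
    (fun _ => rfl) fun _ => rfl

theorem interp_zSpider (n : ℕ) : (zSpider (n + 1)).interp ∅ = ghz := by
  funext x
  rw [ZXDiagram.interp_of_phaseFree_Z _ (fun _ => rfl) fun _ => rfl,
    Finset.sum_eq_single fun _ => x 0, ghz_eq_prod x 0]
  · exact Finset.prod_congr rfl fun j _ => by
      rw [ZXDiagram.edgeOperator_of_notMem _ _ fun _ => Finset.notMem_empty _]
      rfl
  · intro t _ ht
    refine Finset.prod_eq_zero (Finset.mem_univ (0 : Fin (n + 1))) ?_
    rw [ZXDiagram.edgeOperator_of_notMem _ _ fun _ => Finset.notMem_empty _]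
    exact Matrix.one_apply_ne fun h => ht (funext fun _ => h)
  · simp

end GHZ

namespace splitSpider

variable {n : ℕ}

theorem fst_boundaryHalf (j : Fin (n + 1)) :
    ((splitSpider n).boundaryHalf j).1 = Sum.inl j := by
  rw [← (splitSpider n).eq_boundaryHalf (i := j) (h := (Sum.inl j, true)) rfl]

section Legs

variable (G : (splitSpider n).Error)

open Classical in
/-- Whether the edge between the outer spider `i` and the hub `c` carries a flip of type `t`. -/
noncomputable def flipped (t : FlipKind) (i : Fin (n / 2)) (c : Bool) : Bool :=
  decide ((Sum.inr (i, c), t) ∈ G)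

theorem flipped_empty : flipped (∅ : (splitSpider n).Error) = fun _ _ _ => false := by
  funext t i c
  simp [flipped]

theorem edgeOperator_inr (p : Fin (n / 2) × Bool) (a b : Bool) :
    (splitSpider n).edgeOperator G (Sum.inr p) a b =
      if a = (b ^^ flipped G FlipKind.X p.1 p.2) then
        boolSign (b && flipped G FlipKind.Z p.1 p.2) else 0 := by
  rw [ZXDiagram.edgeOperator_apply]
  rfl

/-- The two boundary legs of each outer spider. -/
def outerLeg : Fin (n / 2) × Fin 2 ↪ Fin (n + 1) :=
  finProdFinEquiv.toEmbedding.trans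
    (Fin.castLEEmb ((Nat.div_mul_le_self n 2).trans (Nat.le_succ n)))

/-- The boundary legs at the outer spiders that have an X flip towards the second hub. -/
noncomputable def flippedLegs : Finset (Fin (n + 1)) :=
  ((Finset.univ.filter fun i => flipped G FlipKind.X i true) ×ˢ Finset.univ).map outerLeg

theorem card_flippedLegs :
    (flippedLegs G).card = 2 * (Finset.univ.filter fun i => flipped G FlipKind.X i true).card := by
  rw [flippedLegs, Finset.card_map, Finset.card_product, Finset.card_univ, Fintype.card_fin,
    mul_comm]

theorem mem_flippedLegs {j : Fin (n + 1)} :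
    j ∈ flippedLegs G ↔ ∃ h : j.val / 2 < n / 2, flipped G FlipKind.X ⟨j.val / 2, h⟩ true := by
  simp only [flippedLegs, Finset.mem_map, Finset.mem_product, Finset.mem_filter, Finset.mem_univ,
    true_and, and_true, Prod.exists]
  constructor
  · rintro ⟨i, r, hi, rfl⟩
    have hdiv : (outerLeg (i, r)).val / 2 = i.val := by
      change (r.val + 2 * i.val) / 2 = i.val
      omega
    exact ⟨hdiv ▸ i.isLt, by simpa only [hdiv] using hi⟩
  · rintro ⟨h, hX⟩
    exact ⟨_, ⟨j.val % 2, Nat.mod_lt _ two_pos⟩, hX, Fin.ext (Nat.mod_add_div j.val 2)⟩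

/-- The support of the product of all the Z flips, moved to the last boundary leg. -/
noncomputable def signLegs : Finset (Fin (n + 1)) :=
  if Even (Finset.univ.filter fun p : Fin (n / 2) × Bool => flipped G FlipKind.Z p.1 p.2).card
    then ∅ else {Fin.last n}

theorem prod_boolSign_flipped (x : Fin (n + 1) → Bool) :
    ∏ p : Fin (n / 2) × Bool, boolSign (x (Fin.last n) && flipped G FlipKind.Z p.1 p.2) =
      ∏ j ∈ signLegs G, boolSign (x j) := by
  have hsign (b c : Bool) : boolSign (b && c) = if c then boolSign b else 1 := by
    cases c <;> simp [boolSign]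
  simp only [hsign, Finset.prod_ite, Finset.prod_const_one, mul_one, Finset.prod_const, signLegs]
  split_ifs with heven
  · rw [Finset.prod_empty]
    cases x (Fin.last n) <;> simp [boolSign, heven]
  · rw [Finset.prod_singleton]
    cases x (Fin.last n) <;> simp [boolSign, (Nat.not_even_iff_odd.mp heven).neg_one_pow]

end Legs

section Interp

variable {G : (splitSpider n).Error}

theorem prod_edgeOperator_inl (hG : (splitSpider n).IsInternal G) (x : Fin (n + 1) → Bool)
    (a : Bool → Bool) (ha : a true = x (Fin.last n)) :
    ∏ j : Fin (n + 1), (splitSpider n).edgeOperator G (Sum.inl j)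
        (Sum.elim (Sum.elim (fun i => x (Fin.last n) ^^ flipped G FlipKind.X i true) a) x
          ((splitSpider n).attach (Sum.inl j, false))) (x j) =
      ghz (flipBits (flippedLegs G) x) := by
  have hleg (j : Fin (n + 1)) : Sum.elim (Sum.elim
      (fun i => x (Fin.last n) ^^ flipped G FlipKind.X i true) a) x
        ((splitSpider n).attach (Sum.inl j, false)) = x j ↔
      flipBits (flippedLegs G) x j = flipBits (flippedLegs G) x (Fin.last n) := by
    by_cases hj : j.val / 2 < n / 2
    · by_cases hX : flipped G FlipKind.X ⟨j.val / 2, hj⟩ true <;>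
        cases hxj : x j <;> cases hxl : x (Fin.last n) <;>
        simp [hj, hX, mem_flippedLegs, flipBits, hxj, hxl]
    · cases hxj : x j <;> cases hxl : x (Fin.last n) <;>
        simp [hj, mem_flippedLegs, flipBits, hxj, hxl, ha]
  rw [ghz_eq_prod _ (Fin.last n)]
  refine Finset.prod_congr rfl fun j _ => ?_
  rw [ZXDiagram.edgeOperator_of_notMem _ _ (fst_boundaryHalf j ▸ hG j), Matrix.one_apply,
    Matrix.one_apply]
  exact if_congr ((hleg j).trans eq_comm) rfl rfl

-- The labels of the second hub and of the outer spiders are forced by `x`, so only the label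
-- of the first hub is summed over, here written relative to that of the second.
theorem interp_eq_sum (hG : (splitSpider n).IsInternal G) (x : Fin (n + 1) → Bool) :
    (splitSpider n).interp G x = ∑ d, ghz (flipBits (flippedLegs G) x) *
      ∏ p : Fin (n / 2) × Bool, (splitSpider n).edgeOperator G (Sum.inr p)
        (x (Fin.last n) ^^ flipped G FlipKind.X p.1 true) (x (Fin.last n) ^^ (!p.2 && d)) := by
  rw [ZXDiagram.interp_of_phaseFree_Z _ (fun _ => rfl) fun _ => rfl]
  refine (Fintype.sum_of_injective (fun d => Sum.elim
    (fun i => x (Fin.last n) ^^ flipped G FlipKind.X i true)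
    (fun c => x (Fin.last n) ^^ (!c && d))) (fun d d' h => ?_) _ _ (fun t ht => ?_)
    fun d => ?_).symm
  · simpa using congrFun h (Sum.inr false)
  · by_contra hne
    have hop := Finset.prod_ne_zero_iff.mp hne
    have hhub : t (Sum.inr true) = x (Fin.last n) := by
      have h := hop (Sum.inl (Fin.last n)) (Finset.mem_univ _)
      rw [ZXDiagram.edgeOperator_of_notMem _ _ (fst_boundaryHalf (n := n) _ ▸ hG _)] at h
      simpa using (ite_ne_right_iff.mp h).1
    have houter (i : Fin (n / 2)) :
        t (Sum.inl i) = (x (Fin.last n) ^^ flipped G FlipKind.X i true) := by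
      have h := hop (Sum.inr (i, true)) (Finset.mem_univ _)
      rw [edgeOperator_inr] at h
      exact (ite_ne_right_iff.mp h).1.trans (congrArg (· ^^ _) hhub)
    refine ht ⟨x (Fin.last n) ^^ t (Sum.inr false), funext fun v => ?_⟩
    rcases v with i | _ | _
    · exact (houter i).symm
    · simp
    · simp [hhub]
  · rw [Fintype.prod_sum_type]
    exact congrArg (· * _) (prod_edgeOperator_inl hG x _ (by simp)).symm

variable (G) in
/-- An error is consistent with `d` if, for every outer spider, `d` is the parity of the X flips
on its edges to the two hubs. -/
abbrev Consistent (d : Bool) : Prop :=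
  ∀ i, (flipped G FlipKind.X i false ^^ flipped G FlipKind.X i true) = d

variable (G) in
theorem prod_edgeOperator_inr (b d : Bool) :
    ∏ p : Fin (n / 2) × Bool, (splitSpider n).edgeOperator G (Sum.inr p)
        (b ^^ flipped G FlipKind.X p.1 true) (b ^^ (!p.2 && d)) =
      (if Consistent G d then ∏ i, boolSign (d && flipped G FlipKind.Z i false) else 0) *
        ∏ p : Fin (n / 2) × Bool, boolSign (b && flipped G FlipKind.Z p.1 p.2) := by
  have hpair (i : Fin (n / 2)) :
      ∏ c, (splitSpider n).edgeOperator G (Sum.inr (i, c))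
        (b ^^ flipped G FlipKind.X i true) (b ^^ (!c && d)) =
      (if (flipped G FlipKind.X i false ^^ flipped G FlipKind.X i true) = d then
          boolSign (d && flipped G FlipKind.Z i false) else 0) *
        ∏ c, boolSign (b && flipped G FlipKind.Z i c) := by
    rw [Fintype.prod_bool, Fintype.prod_bool, edgeOperator_inr, edgeOperator_inr]
    cases b <;> cases d <;> cases flipped G FlipKind.X i true <;>
      cases flipped G FlipKind.X i false <;> cases flipped G FlipKind.Z i true <;>
      cases flipped G FlipKind.Z i false <;> simp [boolSign]
  simp only [Fintype.prod_prod_type, hpair, Finset.prod_mul_distrib, Finset.prod_ite_zero,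
    Consistent, Finset.mem_univ, true_imp_iff]

variable (G) in
/-- The scalar that an error leaves behind: the sum over the parities `d` with which it is
consistent, where `d` is also the difference of the labels of the two hubs. -/
noncomputable def hubScalar : ℂ :=
  ∑ d, if Consistent G d then ∏ i, boolSign (d && flipped G FlipKind.Z i false) else 0

theorem interp_eq_hubScalar_smul (hG : (splitSpider n).IsInternal G) :
    (splitSpider n).interp G =
      hubScalar G • applyPauli (flippedLegs G) (signLegs G) ghz := by
  funext x
  simp only [interp_eq_sum hG, prod_edgeOperator_inr, prod_boolSign_flipped, applyPauli, hubScalar,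
    Pi.smul_apply, smul_eq_mul, Finset.sum_mul]
  exact Finset.sum_congr rfl fun d _ => by ring

variable (n) in
theorem hubScalar_empty_ne_zero : hubScalar (∅ : (splitSpider n).Error) ≠ 0 := by
  have hfalse : Consistent (∅ : (splitSpider n).Error) false := fun i => by
    rw [flipped_empty]
    rfl
  have hsign (d : Bool) :
      ∏ i, boolSign (d && flipped (∅ : (splitSpider n).Error) FlipKind.Z i false) = 1 := by
    rw [flipped_empty]
    simp [boolSign]
  rw [hubScalar, Fintype.sum_bool, if_pos hfalse, hsign, hsign]
  split_ifs <;> norm_num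

variable (n) in
theorem eqUpToScalar_interp_ghz :
    EqUpToScalar ((splitSpider n).interp ∅) ghz := by
  refine ⟨_, hubScalar_empty_ne_zero n, ?_⟩
  rw [interp_eq_hubScalar_smul fun i t => Finset.notMem_empty _]
  rw [flippedLegs, signLegs, flipped_empty]
  simp [applyPauli_empty]

end Interp

section Weight

variable {G : (splitSpider n).Error}

open Classical in
theorem mem_image_fst {t : FlipKind} {i : Fin (n / 2)} {c : Bool} (h : flipped G t i c) :
    Sum.inr (i, c) ∈ G.image Prod.fst :=
  Finset.mem_image.mpr ⟨_, of_decide_eq_true h, rfl⟩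

theorem card_flippedLegs_le_weight (h : Consistent G false) :
    (flippedLegs G).card ≤ (splitSpider n).weight G := by
  classical
  calc (flippedLegs G).card
      = ((Finset.univ.filter fun i => flipped G FlipKind.X i true) ×ˢ
          (Finset.univ : Finset Bool)).card := by
        rw [card_flippedLegs, Finset.card_product, Finset.card_univ, Fintype.card_bool, mul_comm]
    _ ≤ (splitSpider n).weight G := by
        refine Finset.card_le_card_of_injOn Sum.inr (fun ⟨i, c⟩ hi => ?_) Sum.inr_injective.injOn
        have htrue : flipped G FlipKind.X i true = true := by simpa using hi
        have hfalse := h i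
        rw [htrue, Bool.xor_true, Bool.not_eq_false'] at hfalse
        exact mem_image_fst (t := FlipKind.X) (by cases c <;> assumption)

theorem div_two_le_weight (h : Consistent G true) : n / 2 ≤ (splitSpider n).weight G := by
  classical
  rw [← Fintype.card_fin (n / 2), ← Finset.card_univ]
  refine Finset.card_le_card_of_injOn (fun i => Sum.inr (i, flipped G FlipKind.X i true))
    (fun i _ => mem_image_fst (t := FlipKind.X) ?_) fun i _ j _ hij => ?_
  · have hi := h i
    cases htrue : flipped G FlipKind.X i true
    · simpa [htrue] using hi
    · exact htrue
  · exact (Prod.mk.inj (Sum.inr.inj hij)).1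

theorem weight_pos_of_signLegs_ne_empty (h : signLegs G ≠ ∅) : 1 ≤ (splitSpider n).weight G := by
  classical
  have hodd : ¬ Even (Finset.univ.filter
      fun p : Fin (n / 2) × Bool => flipped G FlipKind.Z p.1 p.2).card :=
    fun heven => h (if_pos heven)
  obtain ⟨p, hp⟩ := Finset.card_pos.mp (Nat.not_even_iff_odd.mp hodd).pos
  exact Finset.card_pos.mpr ⟨_, mem_image_fst (Finset.mem_filter.mp hp).2⟩

theorem exists_card_le_weight_and_applyPauli_eq (hn : n % 4 ≠ 3) {d : Bool} (hd : Consistent G d)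
    (B : Finset (Fin (n + 1))) :
    ∃ A : Finset (Fin (n + 1)), A.card ≤ (splitSpider n).weight G ∧
      applyPauli (flippedLegs G) B ghz =
        applyPauli A B ghz := by
  cases d
  · exact ⟨_, card_flippedLegs_le_weight hd, rfl⟩
  have hweight := div_two_le_weight hd
  -- Since `flippedLegs G` has even cardinality, it or its complement has at most `n / 2` elements.
  by_cases hcard : (flippedLegs G).card ≤ n / 2
  · exact ⟨_, hcard.trans hweight, rfl⟩
  · refine ⟨(flippedLegs G)ᶜ, ?_, (applyPauli_compl_ghz _ B).symm⟩
    rw [Finset.card_compl, Fintype.card_fin]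
    rw [card_flippedLegs] at hcard ⊢
    omega

theorem exists_eqUpToScalar_applyPauli (hn : n % 4 ≠ 3) {d : Bool} (hd : Consistent G d) :
    ∃ A B : Finset (Fin (n + 1)), (A ∪ B).card ≤ (splitSpider n).weight G ∧
      EqUpToScalar (applyPauli (flippedLegs G) (signLegs G) ghz)
        (applyPauli A B ghz) := by
  obtain ⟨A, hA, heq⟩ := exists_card_le_weight_and_applyPauli_eq hn hd (signLegs G)
  rw [heq]
  by_cases hB : signLegs G = ∅
  · exact ⟨A, _, by rwa [hB, Finset.union_empty], EqUpToScalar.refl _⟩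
  · have hpos := weight_pos_of_signLegs_ne_empty hB
    obtain ⟨j, hcard, hj⟩ :=
      exists_card_union_singleton_le_and_eqUpToScalar_ghz A (Fin.last n)
    refine ⟨A, {j}, hcard.trans (max_le hA hpos), ?_⟩
    rwa [signLegs, if_neg fun heven => hB (if_pos heven)]

end Weight

theorem interp_eq_zero_or_exists_applyPauli (hn : n % 4 ≠ 3) {G : (splitSpider n).Error}
    (hG : (splitSpider n).IsInternal G) :
    (splitSpider n).interp G = 0 ∨ ∃ A B : Finset (Fin (n + 1)),
      (A ∪ B).card ≤ (splitSpider n).weight G ∧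
        EqUpToScalar ((splitSpider n).interp G)
          (applyPauli A B ghz) := by
  rw [interp_eq_hubScalar_smul hG]
  by_cases hscalar : hubScalar G = 0
  · exact Or.inl (by rw [hscalar, zero_smul])
  obtain ⟨d, -, hd⟩ := Finset.exists_ne_zero_of_sum_ne_zero hscalar
  obtain ⟨A, B, hcard, heq⟩ := exists_eqUpToScalar_applyPauli hn (ite_ne_right_iff.mp hd).1
  exact Or.inr ⟨A, B, hcard, EqUpToScalar.trans ⟨_, hscalar, rfl⟩ heq⟩

end splitSpider

theorem ZXPattern.distanceNonDecreasing_of_isEmpty_internalEdge {ι : Type} [Finite ι]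
    {P Q : ZXPattern ι} [IsEmpty Q.InternalEdge]
    (hinterp : EqUpToScalar (Q.interp ∅) (P.interp ∅)) : DistanceNonDecreasing P Q := by
  classical
  refine distanceNonDecreasing_of_applyPauli hinterp fun G hG => Or.inr ⟨∅, ∅, by simp, ?_⟩
  have hempty : G = ∅ := Finset.eq_empty_of_forall_notMem fun ⟨e, t⟩ he => by
    obtain ⟨e', -⟩ | ⟨i, rfl⟩ := Q.exists_internalEdge_or_exists_boundaryHalf e
    · exact isEmptyElim e'
    · exact hG i t he
  rwa [hempty, applyPauli_empty]

instance (k : ℕ) : IsEmpty (zSpider k).InternalEdge := ⟨fun e => by simpa using e.2 true⟩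

-- For odd `n` the last two boundary legs of `splitSpider n` are both attached to its second hub.
theorem mainTheorem4_general (n : ℕ) (hn : n % 4 ≠ 3) :
    ZXPattern.DistancePreserving (zSpider (n + 1)) (splitSpider n) := by
  have hinterp : EqUpToScalar ((splitSpider n).interp ∅) ((zSpider (n + 1)).interp ∅) := by
    rw [interp_zSpider]
    exact splitSpider.eqUpToScalar_interp_ghz n
  refine ⟨hinterp.symm, ZXPattern.distanceNonDecreasing_of_applyPauli hinterp fun _ hG => ?_,
    ZXPattern.distanceNonDecreasing_of_isEmpty_internalEdge hinterp.symm⟩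
  rw [interp_zSpider]
  exact splitSpider.interp_eq_zero_or_exists_applyPauli hn hG

theorem mainTheorem4 (n : ℕ) (hn : Even n) :
    ZXPattern.DistancePreserving (zSpider (n + 1)) (splitSpider n) := by
  obtain ⟨k, rfl⟩ := hn
  exact mainTheorem4_general _ (by omega)
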